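/- **Setting.** Consider the linear system $x(k+1)=Ax(k)+Bu(k)$ with $x(k)\in\mathbb R^n$, $u(k)\in\mathbb R^m$, and the constraint sets $\mathcal X=\{x: C_xx\le d_x\}$, $\mathcal U=\{u: C_uu\le d_u\}$, which are assumed to be compact, with $d_x\in\mathbb R^{q_x}$, $d_u\in\mathbb R^{q_u}$ having strictly positive entries. Let $Q\succeq0$, $R\succ0$ be symmetric, $N\ge1$, $\varepsilon>0$, and let $w_x,w_u$ be vectors with nonnegative entries such that $C_x^\top\mathrm{diag}(1/d_x^1,\dots,1/d_x^{q_x})(\mathbf 1+w_x)=0$ and $C_u^\top\mathrm{diag}(1/d_u^1,\dots,1/d_u^{q_u})(\mathbf 1+w_u)=0$. For $\delta>0$ put $\hat B(z)=-\ln z$ for $z>\delta$, $\hat B(z)=\frac12\big[\big(\frac{z-2\delta}{\delta}\big)^2-1\big]-\ln\delta$ for $z\le\delta$, and $$\hat B_x(x)=\sum_i(1+w_x^i)\big(\hat B(-C_x^ix+d_x^i)+\ln d_x^i\big),\qquad \hat B_u(u)=\sum_j(1+w_u^j)\big(\hat B(-C_u^ju+d_u^j)+\ln d_u^j\big),$$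 $M_x=\frac1{2\delta^2}C_x^\top\mathrm{diag}(\mathbf 1+w_x)C_x$, $M_u=\frac1{2\delta^2}C_u^\top\mathrm{diag}(\mathbf 1+w_u)C_u$. Let $P\succ0$ solve the Riccati equation $$P=(A+BK)^\top P(A+BK)+K^\top(R+\varepsilon M_u)K+Q+\varepsilon M_x,\qquad K=-(R+B^\top PB+\varepsilon M_u)^{-1}B^\top PA .$$ For $U=(u_0,\dots,u_{N-1})\in\mathbb R^{Nm}$ and $x\in\mathbb R^n$ let $x_0(U,x)=x$, $x_{k+1}(U,x)=Ax_k(U,x)+Bu_k$, let $\hat\ell(x,u)=x^\top Qx+u^\top Ru+\varepsilon\hat B_x(x)+\varepsilon\hat B_u(u)$, and $$\hat J_N(U,x)=\sum_{k=0}^{N-1}\hat\ell(x_k(U,x),u_k)+x_N(U,x)^\top P\,x_N(U,x),\qquad \hat U^*(x)=\arg\min_U\hat J_N(U,x).$$ The quantities $\hat B_x,\hat B_u,M_x,M_u,P,K,\hat\ell,\hat J_N,\hat U^*$ all depend on $\delta$. **Iteration scheme.** Write $\Pi_0U=u_0$. Call $k_f:\mathbb R^{Nm}\times\mathbb R^n\to\mathbb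 R^m$ *admissible* if $k_f(0,0)=0$ and, for all $(U,x)$ and $x^+=Ax+B\Pi_0U$, $$\hat J_N\big((u_1,\dots,u_{N-1},k_f(U,x)),x^+\big)-\hat J_N(U,x)\le-\hat\ell(x,\Pi_0U).$$ Call $\Psi_o:\mathbb R^{Nm}\times\mathbb R^n\to\mathbb R^{Nm}$ an *optimizer update operator* if there is $\gamma:\mathbb R^{Nm}\times\mathbb R^n\to[0,\infty)$ with $\gamma(U,x)=0\Leftrightarrow\nabla_U\hat J_N(U,x)=0$ and $\hat J_N(\Psi_o(U,x),x)-\hat J_N(U,x)\le-\gamma(U,x)$ for all $(U,x)$. Set $\Phi^0(U,x)=(u_1,\dots,u_{N-1},k_f(U,x))$ and $\Phi^i(U,x)=\Psi_o(\Phi^{i-1}(U,x),Ax+B\Pi_0U)$ for $i\ge1$. For $i_T(0),i_T(1),\dots\in\mathbb N$ the closed loop is $$x(k+1)=Ax(k)+B\Pi_0U(k),\quad U(k+1)=\Phi^{i_T(k)}(U(k),x(k)),\quad x(0)=x_0,\ U(0)=U_0,\quad u(k)=\Pi_0U(k).$$ **Theorem.** Assume $(A,B)$ is controllable, and let $$\mathcal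 X_N=\{x:\exists\,U\in\mathbb R^{Nm},\ u_k\in\mathcal U,\ x_k(U,x)\in\mathcal X\ (k=0,\dots,N-1),\ x_N(U,x)=0\}.$$ For every compact set $\mathcal X_0\subseteq\mathcal X_N^\circ$ (the interior of $\mathcal X_N$) and all tolerance vectors $\hat z_{x,\mathrm{tol}}\in\mathbb R^{q_x}_+$, $\hat z_{u,\mathrm{tol}}\in\mathbb R^{q_u}_+$ (zero included) there are $\bar\delta_0>0$ and $\mu\in\mathcal K_\infty$ (that is, $\mu:[0,\infty)\to[0,\infty)$ is continuous, strictly increasing, unbounded, with $\mu(0)=0$) such that for every $0<\delta\le\bar\delta_0$ and every $P$ as above: the function $k_f(U,x)=K\,x_N(U,x)$ is admissible; and for every admissible $k_f$, every optimizer update operator $\Psi_o$, every $x_0\in\mathcal X_0$, every $U_0$ with $\|U_0-\hat U^*(x_0)\|\le\mu(\delta)$ (Euclidean norm), every sequence $i_T(0),i_T(1),\dots\in\mathbb N$ and every $k\in\mathbb N$, $$C_xx(k)\le d_x+\hat z_{x,\mathrm{tol}},\qquad C_uu(k)\le d_u+\hat z_{u,\mathrm{tol}} .$$ -/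

import Mathlib

namespace RelaxedMPC

open scoped Matrix

/-- A class `K∞` function on `[0, ∞)`: vanishing at zero, continuous, strictly increasing and
unbounded. Only the values on `[0, ∞)` matter. -/
structure IsKInfty (α : ℝ → ℝ) : Prop where
  zero : α 0 = 0
  continuousOn : ContinuousOn α (Set.Ici 0)
  strictMonoOn : StrictMonoOn α (Set.Ici 0)
  tendsto : Filter.Tendsto α Filter.atTop Filter.atTop

/-- The polyhedron `{ξ | C ξ ≤ d}` (componentwise inequality). -/
def polyhedron {q r : ℕ} (C : Matrix (Fin q) (Fin r) ℝ) (d : Fin q → ℝ) : Set (Fin r → ℝ) :=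
  {ξ | ∀ i, (C *ᵥ ξ) i ≤ d i}

/-- The relaxed logarithmic barrier function for `[0, ∞)` with relaxation parameter `δ`. -/
noncomputable def relaxedLog (δ z : ℝ) : ℝ :=
  if δ < z then -Real.log z
  else (1 / 2) * (((z - 2 * δ) / δ) ^ 2 - 1) - Real.log δ

/-- The weight-recentered relaxed logarithmic barrier function of `{ξ | C ξ ≤ d}`. -/
noncomputable def relaxedBarrier {q r : ℕ} (C : Matrix (Fin q) (Fin r) ℝ) (d w : Fin q → ℝ)
    (δ : ℝ) (ξ : Fin r → ℝ) : ℝ :=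
  ∑ i, (1 + w i) * (relaxedLog δ (-(C *ᵥ ξ) i + d i) + Real.log (d i))

/-- The recentering condition `Cᵀ diag(1/d¹, …, 1/d^q) (1 + w) = 0`. -/
def IsRecentering {q r : ℕ} (C : Matrix (Fin q) (Fin r) ℝ) (d w : Fin q → ℝ) : Prop :=
  Cᵀ *ᵥ (fun i => (1 / d i) * (1 + w i)) = 0

/-- The matrix `(1 / (2 δ²)) Cᵀ diag(1 + w) C`. -/
noncomputable def barrierBound {q r : ℕ} (C : Matrix (Fin q) (Fin r) ℝ) (w : Fin q → ℝ)
    (δ : ℝ) : Matrix (Fin r) (Fin r) ℝ :=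
  (1 / (2 * δ ^ 2)) • (Cᵀ * Matrix.diagonal (fun i => 1 + w i) * C)

/-- Controllability of `(A, B)`: the matrix `[B, AB, …, A^(n-1) B]` has rank `n`. -/
def IsControllable {n m : ℕ} (A : Matrix (Fin n) (Fin n) ℝ) (B : Matrix (Fin n) (Fin m) ℝ) :
    Prop :=
  (Matrix.of fun (i : Fin n) (p : Fin n × Fin m) => (A ^ (p.1 : ℕ) * B) i p.2).rank = n

/-- State vectors. -/
abbrev State (n : ℕ) : Type := Fin n → ℝ

/-- Stacked input vectors `U = (u_0, …, u_(N-1)) ∈ ℝ^(N m)` with the Euclidean norm. -/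
abbrev InputSeq (N m : ℕ) : Type := EuclideanSpace ℝ (Fin N × Fin m)

/-- The block `u_k` of `U`, for `k < N` (zero for other indices, which are never used). -/
def block {N m : ℕ} (U : InputSeq N m) (k : ℕ) : Fin m → ℝ :=
  fun j => if h : k < N then U (⟨k, h⟩, j) else 0

/-- The shifted input vector `(u_1, …, u_(N-1), v)`. -/
noncomputable def shift {N m : ℕ} (U : InputSeq N m) (v : Fin m → ℝ) : InputSeq N m :=
  WithLp.toLp 2 fun p => if (p.1 : ℕ) + 1 < N then block U ((p.1 : ℕ) + 1) p.2 else v p.2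

/-- The data of the control problem: system matrices `A`, `B`, cost weights `Q`, `R`, state
constraints `Cx x ≤ dx`, input constraints `Cu u ≤ du`, recentering weights `wx`, `wu` and the
barrier weighting parameter `ε`; the horizon is the parameter `N`. -/
structure Setup (n m N qx qu : ℕ) where
  A : Matrix (Fin n) (Fin n) ℝ
  B : Matrix (Fin n) (Fin m) ℝ
  Q : Matrix (Fin n) (Fin n) ℝ
  R : Matrix (Fin m) (Fin m) ℝ
  Cx : Matrix (Fin qx) (Fin n) ℝ
  dx : Fin qx → ℝ
  Cu : Matrix (Fin qu) (Fin m) ℝ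
  du : Fin qu → ℝ
  wx : Fin qx → ℝ
  wu : Fin qu → ℝ
  ε : ℝ

namespace Setup

variable {n m N qx qu : ℕ} (S : Setup n m N qx qu)

/-- The state constraint set. -/
def stateSet : Set (State n) := polyhedron S.Cx S.dx

/-- The input constraint set. -/
def inputSet : Set (Fin m → ℝ) := polyhedron S.Cu S.du

/-- The standing assumptions on the problem data. -/
structure Valid : Prop where
  horizon_pos : 0 < N
  Q_posSemidef : S.Q.PosSemidef
  R_posDef : S.R.PosDef
  dx_pos : ∀ i, 0 < S.dx i
  du_pos : ∀ i, 0 < S.du i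
  isCompact_stateSet : IsCompact S.stateSet
  isCompact_inputSet : IsCompact S.inputSet
  wx_nonneg : ∀ i, 0 ≤ S.wx i
  wu_nonneg : ∀ i, 0 ≤ S.wu i
  wx_recentering : IsRecentering S.Cx S.dx S.wx
  wu_recentering : IsRecentering S.Cu S.du S.wu
  ε_pos : 0 < S.ε

/-- One step `A x + B u` of the plant. -/
def next (x : State n) (u : Fin m → ℝ) : State n := S.A *ᵥ x + S.B *ᵥ u

/-- The predicted state `x_k(U, x)`, for `k ≤ N`. -/
def predState (U : InputSeq N m) (x : State n) : ℕ → State n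
  | 0 => x
  | k + 1 => S.next (predState U x k) (block U k)

/-- The modified stage cost `‖x‖²_Q + ‖u‖²_R + ε B̂_x(x) + ε B̂_u(u)`. -/
noncomputable def stageCost (δ : ℝ) (x : State n) (u : Fin m → ℝ) : ℝ :=
  x ⬝ᵥ (S.Q *ᵥ x) + u ⬝ᵥ (S.R *ᵥ u)
    + S.ε * relaxedBarrier S.Cx S.dx S.wx δ x + S.ε * relaxedBarrier S.Cu S.du S.wu δ u

/-- The relaxed barrier function based cost function `Ĵ_N(U, x)` with terminal cost `xᵀ P x`. -/
noncomputable def cost (δ : ℝ) (P : Matrix (Fin n) (Fin n) ℝ) (U : InputSeq N m)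
    (x : State n) : ℝ :=
  ∑ k ∈ Finset.range N, S.stageCost δ (S.predState U x k) (block U k)
    + S.predState U x N ⬝ᵥ (P *ᵥ S.predState U x N)

/-- The gain `K = -(R + Bᵀ P B + ε M_u)⁻¹ Bᵀ P A`. -/
noncomputable def gain (δ : ℝ) (P : Matrix (Fin n) (Fin n) ℝ) : Matrix (Fin m) (Fin n) ℝ :=
  -((S.R + S.Bᵀ * P * S.B + S.ε • barrierBound S.Cu S.wu δ)⁻¹ * (S.Bᵀ * P * S.A))

/-- `P` is a positive definite solution of the algebraic Riccati equation
`P = (A + B K)ᵀ P (A + B K) + Kᵀ (R + ε M_u) K + Q + ε M_x`. -/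
structure IsTerminalWeight (δ : ℝ) (P : Matrix (Fin n) (Fin n) ℝ) : Prop where
  posDef : P.PosDef
  riccati : P = (S.A + S.B * S.gain δ P)ᵀ * P * (S.A + S.B * S.gain δ P)
    + (S.gain δ P)ᵀ * (S.R + S.ε • barrierBound S.Cu S.wu δ) * S.gain δ P
    + S.Q + S.ε • barrierBound S.Cx S.wx δ

/-- The functions `k_f` that may be used in the warm start `(u_1, …, u_(N-1), k_f(U, x))`. -/
structure IsTerminalFeedback (δ : ℝ) (P : Matrix (Fin n) (Fin n) ℝ)
    (kf : InputSeq N m → State n → Fin m → ℝ) : Prop where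
  zero : kf 0 0 = 0
  decrease : ∀ U x,
    S.cost δ P (shift U (kf U x)) (S.next x (block U 0)) - S.cost δ P U x
      ≤ -S.stageCost δ x (block U 0)

/-- The optimizer update operators `Ψ_o`: each update decreases the cost by at least `γ(U, x) ≥ 0`,
which vanishes exactly at the stationary points of `Ĵ_N(·, x)`. -/
def IsOptimizerUpdate (δ : ℝ) (P : Matrix (Fin n) (Fin n) ℝ)
    (Ψ : InputSeq N m → State n → InputSeq N m) : Prop :=
  ∃ γ : InputSeq N m → State n → ℝ,
    (∀ U x, 0 ≤ γ U x) ∧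
    (∀ U x, γ U x = 0 ↔ gradient (fun V => S.cost δ P V x) U = 0) ∧
    ∀ U x, S.cost δ P (Ψ U x) x - S.cost δ P U x ≤ -γ U x

/-- The operator `Φ^i(U, x)`: warm start by shifting, then `i` optimizer updates for the predicted
next state. -/
noncomputable def algo (kf : InputSeq N m → State n → Fin m → ℝ)
    (Ψ : InputSeq N m → State n → InputSeq N m) (U : InputSeq N m) (x : State n) :
    ℕ → InputSeq N m
  | 0 => shift U (kf U x)
  | i + 1 => Ψ (algo kf Ψ U x i) (S.next x (block U 0))

/-- The closed-loop trajectory `k ↦ (x(k), U(k))` when `iT k` optimizer updates are performed at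
time `k`. -/
noncomputable def closedLoop (kf : InputSeq N m → State n → Fin m → ℝ)
    (Ψ : InputSeq N m → State n → InputSeq N m) (iT : ℕ → ℕ) (U₀ : InputSeq N m)
    (x₀ : State n) : ℕ → State n × InputSeq N m
  | 0 => (x₀, U₀)
  | k + 1 =>
    let z := closedLoop kf Ψ iT U₀ x₀ k
    (S.next z.1 (block z.2 0), S.algo kf Ψ z.2 z.1 (iT k))

/-- The set of states that can be steered to the origin in `N` steps while satisfying all
constraints (`x_N = 0` satisfies the state constraints automatically). -/
def feasibleSet : Set (State n) :=
  {x | ∃ U : InputSeq N m,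
    (∀ k < N, block U k ∈ S.inputSet) ∧
    (∀ k < N, S.predState U x k ∈ S.stateSet) ∧
    S.predState U x N = 0}

end Setup

end RelaxedMPC

/-! The cost is a Lyapunov function for the whole scheme: a warm start saves the stage cost just
paid, and optimizer updates only lower the cost. So every stage cost in closed loop is at most the
initial cost. A violated constraint makes the relaxed barrier at least `1/2 + log (d i / δ)`, which
is unbounded as `δ → 0`. It therefore suffices to bound the initial cost uniformly in `δ`; for small
`δ` even the original constraints hold, with no tolerance.

Two estimates give this bound. Compactness of `X₀` inside the interior lets all its states be
steered to the origin with a common relative slack `s`; there the barriers are plain logarithms,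
bounded through `-log s`, so the optimal cost is at most some `α` (`exists_uniform_cost_bound`). For
`U₀` near the minimizer, the relaxed logarithm has curvature at most `1 / δ ^ 2`, so the symmetric
second difference of the cost is bounded by a quadratic form (`cost_add_sub_le`). The matrix `P`,
which depends on `δ`, is controlled through the Riccati equation by the quadratic cost of a
trajectory reaching the origin. All these quantities grow at most like `1 / δ ^ 2`, so `μ δ = r * δ`
keeps the excess cost below `2`. -/

namespace RelaxedMPC

open scoped Matrix

/-! ### Scalar estimates: tangents, curvature and growth of the relaxed logarithm. -/

section RelaxedLog

variable {δ d s z h : ℝ}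

lemma relaxedLog_of_le (hz : z ≤ δ) :
    relaxedLog δ z = (1 / 2) * (((z - 2 * δ) / δ) ^ 2 - 1) - Real.log δ :=
  if_neg hz.not_gt

lemma relaxedLog_of_ge (hδ : 0 < δ) (hz : δ ≤ z) : relaxedLog δ z = -Real.log z := by
  rcases hz.lt_or_eq with hz | rfl
  · exact if_pos hz
  · rw [relaxedLog_of_le le_rfl]
    field_simp
    ring

/-- Convexity, by hand: `log y ≤ y - 1` settles the logarithmic branch. The quadratic branch lies
above its own tangent at `δ`, which to the left of `δ` rises faster than the tangent at `d`. -/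
lemma tangent_le_relaxedLog (hδ : 0 < δ) (hd : δ ≤ d) :
    -Real.log d - (z - d) / d ≤ relaxedLog δ z := by
  have hd0 : 0 < d := hδ.trans_le hd
  have key : ∀ y, 0 < y → -Real.log d - (y - d) / d ≤ -Real.log y := fun y hy => by
    have h1 := Real.log_le_sub_one_of_pos (div_pos hy hd0)
    rw [Real.log_div hy.ne' hd0.ne'] at h1
    have h2 : (y - d) / d = y / d - 1 := by field_simp
    linarith
  rcases le_total δ z with hz | hz
  · rw [relaxedLog_of_ge hδ hz]
    exact key z (hδ.trans_le hz)
  · rw [relaxedLog_of_le hz]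
    have h1 := key δ hδ
    have h2 : (δ - z) / d ≤ (δ - z) / δ :=
      div_le_div_of_nonneg_left (sub_nonneg.2 hz) hδ hd
    have h3 : (1 / 2) * (((z - 2 * δ) / δ) ^ 2 - 1) = (δ - z) / δ + 1 / 2 * ((δ - z) / δ) ^ 2 := by
      field_simp
      ring
    have h4 : (δ - z) / d = (δ - d) / d - (z - d) / d := by ring
    nlinarith [sq_nonneg ((δ - z) / δ)]

lemma hasDerivAt_sq_sub_relaxedLog (hδ : 0 < δ) (z : ℝ) :
    HasDerivAt (fun z => z ^ 2 / (2 * δ ^ 2) - relaxedLog δ z)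
      (max z δ / δ ^ 2 + 1 / max z δ) z := by
  have lower : ∀ z, HasDerivAt
      (fun z => z ^ 2 / (2 * δ ^ 2) - ((1 / 2) * (((z - 2 * δ) / δ) ^ 2 - 1) - Real.log δ))
      (δ / δ ^ 2 + 1 / δ) z := fun z => by
    have h1 : (fun z => z ^ 2 / (2 * δ ^ 2)
        - ((1 / 2) * (((z - 2 * δ) / δ) ^ 2 - 1) - Real.log δ))
        = fun z => (δ / δ ^ 2 + 1 / δ) * z + (Real.log δ - 3 / 2) := by
      funext z
      field_simp
      ring
    rw [h1]
    simpa using ((hasDerivAt_id z).const_mul (δ / δ ^ 2 + 1 / δ)).add_const (Real.log δ - 3 / 2)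
  have upper : ∀ z, 0 < z → HasDerivAt (fun z => z ^ 2 / (2 * δ ^ 2) - -Real.log z)
      (z / δ ^ 2 + 1 / z) z := fun z hz => by
    have h1 := ((hasDerivAt_pow 2 z).div_const (2 * δ ^ 2)).sub (Real.hasDerivAt_log hz.ne').neg
    refine h1.congr_deriv ?_
    field_simp
    ring
  rcases lt_trichotomy z δ with hz | hz | hz
  · rw [max_eq_right hz.le]
    refine (lower z).congr_of_eventuallyEq ?_
    filter_upwards [Iio_mem_nhds hz] with y hy
    rw [relaxedLog_of_le (le_of_lt hy)]
  · subst hz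
    rw [max_self]
    have h1 : HasDerivWithinAt (fun y => y ^ 2 / (2 * z ^ 2) - relaxedLog z y)
        (z / z ^ 2 + 1 / z) (Set.Iic z) z :=
      (lower z).hasDerivWithinAt.congr (fun y hy => by rw [relaxedLog_of_le hy])
        (by rw [relaxedLog_of_le le_rfl])
    have h2 : HasDerivWithinAt (fun y => y ^ 2 / (2 * z ^ 2) - relaxedLog z y)
        (z / z ^ 2 + 1 / z) (Set.Ici z) z :=
      (upper z hδ).hasDerivWithinAt.congr (fun y hy => by rw [relaxedLog_of_ge hδ hy])
        (by rw [relaxedLog_of_ge hδ le_rfl])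
    have h3 := h1.union h2
    rwa [Set.Iic_union_Ici, hasDerivWithinAt_univ] at h3
  · rw [max_eq_left hz.le]
    refine (upper z (hδ.trans hz)).congr_of_eventuallyEq ?_
    filter_upwards [Ioi_mem_nhds hz] with y hy
    rw [relaxedLog_of_ge hδ (le_of_lt hy)]

/-- This encodes "curvature at most `1 / δ ^ 2`" without second derivatives. The bound is attained
on the quadratic branch, where the difference is affine. -/
lemma convexOn_sq_sub_relaxedLog (hδ : 0 < δ) :
    ConvexOn ℝ Set.univ (fun z => z ^ 2 / (2 * δ ^ 2) - relaxedLog δ z) := by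
  refine Monotone.convexOn_univ_of_deriv
    (fun z => (hasDerivAt_sq_sub_relaxedLog hδ z).differentiableAt) ?_
  have h1 : deriv (fun z => z ^ 2 / (2 * δ ^ 2) - relaxedLog δ z)
      = fun z => max z δ / δ ^ 2 + 1 / max z δ :=
    funext fun z => (hasDerivAt_sq_sub_relaxedLog hδ z).deriv
  rw [h1]
  have key : ∀ a b, δ ≤ a → a ≤ b → a / δ ^ 2 + 1 / a ≤ b / δ ^ 2 + 1 / b := by
    intro a b ha hab
    have ha0 : 0 < a := hδ.trans_le ha
    have hb0 : 0 < b := ha0.trans_le hab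
    have h2 : b / δ ^ 2 + 1 / b - (a / δ ^ 2 + 1 / a)
        = (b - a) * (a * b - δ ^ 2) / (δ ^ 2 * (a * b)) := by
      field_simp
      ring
    have h3 : 0 ≤ (b - a) * (a * b - δ ^ 2) / (δ ^ 2 * (a * b)) :=
      div_nonneg (mul_nonneg (by linarith) (by nlinarith)) (by positivity)
    linarith
  exact fun a b hab => key _ _ (le_max_right _ _) (max_le_max_right _ hab)

lemma relaxedLog_le_tangent_add_sq (hδ : 0 < δ) (hd : δ ≤ d) :
    relaxedLog δ z ≤ -Real.log d - (z - d) / d + (z - d) ^ 2 / (2 * δ ^ 2) := by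
  have hd0 : 0 < d := hδ.trans_le hd
  have hder := hasDerivAt_sq_sub_relaxedLog hδ d
  rw [max_eq_left hd] at hder
  have hconv := convexOn_sq_sub_relaxedLog hδ
  have h1 : d ^ 2 / (2 * δ ^ 2) - relaxedLog δ d + (d / δ ^ 2 + 1 / d) * (z - d)
      ≤ z ^ 2 / (2 * δ ^ 2) - relaxedLog δ z := by
    rcases lt_trichotomy z d with hz | rfl | hz
    · have := hconv.slope_le_of_hasDerivAt (Set.mem_univ z) (Set.mem_univ d) hz hder
      rw [slope_def_field, div_le_iff₀ (by linarith)] at this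
      linarith
    · simp
    · have := hconv.le_slope_of_hasDerivAt (Set.mem_univ d) (Set.mem_univ z) hz hder
      rw [slope_def_field, le_div_iff₀ (by linarith)] at this
      linarith
  rw [relaxedLog_of_ge hδ hd] at h1
  have h2 : (z - d) ^ 2 / (2 * δ ^ 2)
      = z ^ 2 / (2 * δ ^ 2) - d ^ 2 / (2 * δ ^ 2) - d / δ ^ 2 * (z - d) := by
    field_simp
    ring
  have h3 : (z - d) / d = 1 / d * (z - d) := by ring
  rw [h2, h3]
  linarith

lemma relaxedLog_add_sub_le (hδ : 0 < δ) (z h : ℝ) :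
    relaxedLog δ (z + h) + relaxedLog δ (z - h) - 2 * relaxedLog δ z ≤ h ^ 2 / δ ^ 2 := by
  have h1 := (convexOn_sq_sub_relaxedLog hδ).2 (Set.mem_univ (z + h)) (Set.mem_univ (z - h))
    (by norm_num : (0 : ℝ) ≤ 1 / 2) (by norm_num : (0 : ℝ) ≤ 1 / 2) (by norm_num)
  simp only [smul_eq_mul] at h1
  have h2 : 1 / 2 * (z + h) + 1 / 2 * (z - h) = z := by ring
  rw [h2] at h1
  have h3 : h ^ 2 / δ ^ 2 = (z + h) ^ 2 / (2 * δ ^ 2) + (z - h) ^ 2 / (2 * δ ^ 2)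
      - 2 * (z ^ 2 / (2 * δ ^ 2)) := by
    field_simp
    ring
  linarith

/-- At `z = 0` this is an equality; to the left the slope is at most `-2 / δ`, which outweighs the
added `1 / d`. -/
lemma le_relaxedLog_of_neg (hδ : 0 < δ) (hd : δ ≤ d) (hz : z ≤ 0) :
    3 / 2 - Real.log δ ≤ relaxedLog δ z + z / d := by
  rw [relaxedLog_of_le (hz.trans hδ.le)]
  have h1 : (-z) / d ≤ (-z) / δ := div_le_div_of_nonneg_left (by linarith) hδ hd
  have h2 : (1 / 2) * (((z - 2 * δ) / δ) ^ 2 - 1)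
      = 3 / 2 + 2 * ((-z) / δ) + 1 / 2 * ((-z) / δ) ^ 2 := by
    field_simp
    ring
  have h3 : 0 ≤ (-z) / δ := div_nonneg (by linarith) hδ.le
  have h4 : (-z) / d = -(z / d) := by ring
  nlinarith [sq_nonneg ((-z) / δ)]

end RelaxedLog

/-! ### Barrier functions of polyhedra. -/

section RelaxedBarrier

variable {q r : ℕ} {C : Matrix (Fin q) (Fin r) ℝ} {d w : Fin q → ℝ} {δ : ℝ}

lemma dotProduct_barrierBound_mulVec (C : Matrix (Fin q) (Fin r) ℝ) (w : Fin q → ℝ) (δ : ℝ)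
    (ξ η : Fin r → ℝ) :
    ξ ⬝ᵥ (barrierBound C w δ *ᵥ η)
      = ∑ i, (1 + w i) * ((C *ᵥ ξ) i * (C *ᵥ η) i / (2 * δ ^ 2)) := by
  rw [barrierBound, Matrix.smul_mulVec, dotProduct_smul, Matrix.mul_assoc, ← Matrix.mulVec_mulVec,
    Matrix.dotProduct_mulVec, Matrix.vecMul_transpose, ← Matrix.mulVec_mulVec, dotProduct,
    smul_eq_mul, Finset.mul_sum]
  refine Finset.sum_congr rfl fun i _ => ?_
  rw [Matrix.mulVec_diagonal]
  ring

lemma barrierBound_posSemidef (C : Matrix (Fin q) (Fin r) ℝ) (hw : ∀ i, 0 ≤ w i) (δ : ℝ) :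
    (barrierBound C w δ).PosSemidef := by
  have h1 : (Matrix.diagonal fun i => 1 + w i).PosSemidef :=
    Matrix.posSemidef_diagonal_iff.2 fun i => by linarith [hw i]
  have h2 := h1.conjTranspose_mul_mul_same C
  rw [Matrix.conjTranspose_eq_transpose_of_trivial] at h2
  exact h2.smul (by positivity)

lemma IsRecentering.sum_eq_zero (h : IsRecentering C d w) (ξ : Fin r → ℝ) :
    ∑ i, (1 + w i) * ((C *ᵥ ξ) i / d i) = 0 := by
  have h1 : (fun i => (1 / d i) * (1 + w i)) ⬝ᵥ (C *ᵥ ξ) = 0 := by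
    rw [Matrix.dotProduct_mulVec, ← Matrix.mulVec_transpose]
    rw [IsRecentering] at h
    rw [h, zero_dotProduct]
  rw [dotProduct] at h1
  rw [← h1]
  exact Finset.sum_congr rfl fun i _ => by ring

/-- The inserted linear terms sum to zero by recentering. Each summand becomes the gap between the
relaxed logarithm and its tangent at `d i`, so summands can be estimated one by one. -/
lemma IsRecentering.relaxedBarrier_eq (h : IsRecentering C d w) (δ : ℝ) (ξ : Fin r → ℝ) :
    relaxedBarrier C d w δ ξ = ∑ i, (1 + w i) *
      (relaxedLog δ (-(C *ᵥ ξ) i + d i) + Real.log (d i) - (C *ᵥ ξ) i / d i) := by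
  rw [relaxedBarrier, ← sub_zero (∑ i, _), ← h.sum_eq_zero ξ, ← Finset.sum_sub_distrib]
  exact Finset.sum_congr rfl fun i _ => by ring

lemma relaxedBarrier_term_nonneg (hδ : 0 < δ) (hd : ∀ i, δ ≤ d i) (i : Fin q)
    (ξ : Fin r → ℝ) :
    0 ≤ relaxedLog δ (-(C *ᵥ ξ) i + d i) + Real.log (d i) - (C *ᵥ ξ) i / d i := by
  have h1 := tangent_le_relaxedLog (z := -(C *ᵥ ξ) i + d i) hδ (hd i)
  have h2 : (-(C *ᵥ ξ) i + d i - d i) / d i = -((C *ᵥ ξ) i / d i) := by ring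
  linarith

lemma relaxedBarrier_nonneg (h : IsRecentering C d w) (hw : ∀ i, 0 ≤ w i) (hδ : 0 < δ)
    (hd : ∀ i, δ ≤ d i) (ξ : Fin r → ℝ) : 0 ≤ relaxedBarrier C d w δ ξ := by
  rw [h.relaxedBarrier_eq]
  exact Finset.sum_nonneg fun i _ => mul_nonneg (by linarith [hw i])
    (relaxedBarrier_term_nonneg hδ hd i ξ)

lemma relaxedBarrier_le (h : IsRecentering C d w) (hw : ∀ i, 0 ≤ w i) (hδ : 0 < δ)
    (hd : ∀ i, δ ≤ d i) (ξ : Fin r → ℝ) :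
    relaxedBarrier C d w δ ξ ≤ ξ ⬝ᵥ (barrierBound C w δ *ᵥ ξ) := by
  rw [h.relaxedBarrier_eq, dotProduct_barrierBound_mulVec]
  refine Finset.sum_le_sum fun i _ => mul_le_mul_of_nonneg_left ?_ (by linarith [hw i])
  have h1 := relaxedLog_le_tangent_add_sq (z := -(C *ᵥ ξ) i + d i) hδ (hd i)
  have h2 : (-(C *ᵥ ξ) i + d i - d i) / d i = -((C *ᵥ ξ) i / d i) := by ring
  have h3 : (-(C *ᵥ ξ) i + d i - d i) ^ 2 = (C *ᵥ ξ) i * (C *ᵥ ξ) i := by ring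
  rw [h2, h3] at h1
  linarith

/-- All recentered summands are nonnegative, so the violated constraint alone gives the bound. The
`1/2` is the `3/2` of the scalar estimate minus the `1` in `z / d i = 1 - (C *ᵥ ξ) i / d i`. -/
lemma le_relaxedBarrier_of_violated (h : IsRecentering C d w) (hw : ∀ i, 0 ≤ w i) (hδ : 0 < δ)
    (hd : ∀ i, δ ≤ d i) {ξ : Fin r → ℝ} {i : Fin q} (hi : d i ≤ (C *ᵥ ξ) i) :
    1 / 2 + Real.log (d i / δ) ≤ relaxedBarrier C d w δ ξ := by
  rw [h.relaxedBarrier_eq]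
  have hd0 : 0 < d i := hδ.trans_le (hd i)
  have h0 := relaxedBarrier_term_nonneg (C := C) hδ hd i ξ
  have h1 := Finset.single_le_sum (f := fun i => (1 + w i) *
      (relaxedLog δ (-(C *ᵥ ξ) i + d i) + Real.log (d i) - (C *ᵥ ξ) i / d i))
    (fun i _ => mul_nonneg (by linarith [hw i]) (relaxedBarrier_term_nonneg hδ hd i ξ))
    (Finset.mem_univ i)
  have h2 := le_relaxedLog_of_neg (z := -(C *ᵥ ξ) i + d i) hδ (hd i) (by linarith)
  have h3 : (-(C *ᵥ ξ) i + d i) / d i = 1 - (C *ᵥ ξ) i / d i := by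
    field_simp
    ring
  have h4 := mul_nonneg (hw i) h0
  rw [Real.log_div hd0.ne' hδ.ne']
  linarith

lemma relaxedBarrier_add_sub_le (hw : ∀ i, 0 ≤ w i) (hδ : 0 < δ) (ξ η : Fin r → ℝ) :
    relaxedBarrier C d w δ (ξ + η) + relaxedBarrier C d w δ (ξ - η)
      - 2 * relaxedBarrier C d w δ ξ ≤ 2 * (η ⬝ᵥ (barrierBound C w δ *ᵥ η)) := by
  rw [dotProduct_barrierBound_mulVec]
  simp only [relaxedBarrier, Finset.mul_sum]
  rw [← Finset.sum_add_distrib, ← Finset.sum_sub_distrib]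
  refine Finset.sum_le_sum fun i _ => ?_
  have h1 := relaxedLog_add_sub_le hδ (-(C *ᵥ ξ) i + d i) (-(C *ᵥ η) i)
  have h2 : -(C *ᵥ (ξ + η)) i + d i = -(C *ᵥ ξ) i + d i + -(C *ᵥ η) i := by
    rw [Matrix.mulVec_add, Pi.add_apply]
    ring
  have h3 : -(C *ᵥ (ξ - η)) i + d i = -(C *ᵥ ξ) i + d i - -(C *ᵥ η) i := by
    rw [Matrix.mulVec_sub, Pi.sub_apply]
    ring
  have h4 := mul_le_mul_of_nonneg_left h1 (by linarith [hw i] : 0 ≤ 1 + w i)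
  have h5 : 2 * ((1 + w i) * ((C *ᵥ η) i * (C *ᵥ η) i / (2 * δ ^ 2)))
      = (1 + w i) * ((-(C *ᵥ η) i) ^ 2 / δ ^ 2) := by
    field_simp
  rw [h2, h3, h5]
  linarith

/-- The slack keeps every argument above `δ`, on the logarithmic branch, so the bound is free of
`δ`. -/
lemma relaxedBarrier_le_of_slack (hw : ∀ i, 0 ≤ w i) (hδ : 0 < δ) {s : ℝ} (hs : 0 < s)
    (hd0 : ∀ i, 0 < d i) (hd : ∀ i, δ ≤ s * d i) {ξ : Fin r → ℝ}
    (hξ : ∀ i, (C *ᵥ ξ) i ≤ (1 - s) * d i) :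
    relaxedBarrier C d w δ ξ ≤ ∑ i, (1 + w i) * (-Real.log s) := by
  refine Finset.sum_le_sum fun i _ => mul_le_mul_of_nonneg_left ?_ (by linarith [hw i])
  have h1 : s * d i ≤ -(C *ᵥ ξ) i + d i := by linarith [hξ i]
  rw [relaxedLog_of_ge hδ ((hd i).trans h1)]
  have h2 := Real.log_le_log (mul_pos hs (hd0 i)) h1
  rw [Real.log_mul hs.ne' (hd0 i).ne'] at h2
  linarith

end RelaxedBarrier

section Dynamics

variable {N m : ℕ}

lemma block_add (U V : InputSeq N m) (k : ℕ) : block (U + V) k = block U k + block V k := by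
  funext j
  by_cases h : k < N <;> simp [block, h]

lemma block_smul (c : ℝ) (U : InputSeq N m) (k : ℕ) : block (c • U) k = c • block U k := by
  funext j
  by_cases h : k < N <;> simp [block, h]

lemma block_shift_of_lt (U : InputSeq N m) (v : Fin m → ℝ) {k : ℕ} (hk : k + 1 < N) :
    block (shift U v) k = block U (k + 1) := by
  funext j
  have h : k < N := by omega
  simp [block, shift, h, hk]

lemma block_shift_of_eq (U : InputSeq N m) (v : Fin m → ℝ) {k : ℕ} (hk : k + 1 = N) :
    block (shift U v) k = v := by
  funext j
  have h : k < N := by omega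
  simp [block, shift, h, hk]

end Dynamics

/-! ### Linearity of predictions and quadratic majorants of the stage cost. -/

namespace Setup

variable {n m N qx qu : ℕ} (S : Setup n m N qx qu)

lemma next_add (x y : State n) (u v : Fin m → ℝ) :
    S.next (x + y) (u + v) = S.next x u + S.next y v := by
  simp only [next, Matrix.mulVec_add]
  abel

lemma next_smul (c : ℝ) (x : State n) (u : Fin m → ℝ) :
    S.next (c • x) (c • u) = c • S.next x u := by
  simp only [next, Matrix.mulVec_smul, smul_add]

lemma predState_add (U V : InputSeq N m) (x y : State n) (k : ℕ) :
    S.predState (U + V) (x + y) k = S.predState U x k + S.predState V y k := by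
  induction k with
  | zero => rfl
  | succ k ih => simp only [predState, ih, block_add, next_add]

lemma predState_smul (c : ℝ) (U : InputSeq N m) (x : State n) (k : ℕ) :
    S.predState (c • U) (c • x) k = c • S.predState U x k := by
  induction k with
  | zero => rfl
  | succ k ih => simp only [predState, ih, block_smul, next_smul]

/-- The predicted state as a linear function of the inputs and the initial state. -/
def predStateLinear (k : ℕ) : InputSeq N m × State n →ₗ[ℝ] State n where
  toFun p := S.predState p.1 p.2 k
  map_add' p q := S.predState_add p.1 q.1 p.2 q.2 k
  map_smul' c p := S.predState_smul c p.1 p.2 k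

lemma continuous_predState (k : ℕ) :
    Continuous fun p : InputSeq N m × State n => S.predState p.1 p.2 k :=
  (S.predStateLinear k).continuous_of_finiteDimensional

lemma continuous_block (k : ℕ) : Continuous fun U : InputSeq N m => block U k := by
  refine continuous_pi fun j => ?_
  by_cases h : k < N
  · simp only [block, h, dite_true]
    fun_prop
  · simp only [block, h, dite_false]
    fun_prop

lemma predState_zero (k : ℕ) : S.predState (0 : InputSeq N m) 0 k = 0 :=
  (S.predStateLinear k).map_zero

lemma predState_shift (U : InputSeq N m) (v : Fin m → ℝ) (x : State n) {k : ℕ} (hk : k + 1 ≤ N) :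
    S.predState (shift U v) (S.next x (block U 0)) k = S.predState U x (k + 1) := by
  induction k with
  | zero => rfl
  | succ k ih => rw [predState, ih (by omega), block_shift_of_lt U v (by omega)]; rfl

lemma predState_shift_horizon (hN : 0 < N) (U : InputSeq N m) (v : Fin m → ℝ) (x : State n) :
    S.predState (shift U v) (S.next x (block U 0)) N = S.next (S.predState U x N) v := by
  obtain ⟨M, rfl⟩ : ∃ M, N = M + 1 := ⟨N - 1, by omega⟩
  rw [predState, S.predState_shift U v x le_rfl, block_shift_of_eq U v rfl]

/-- The quadratic upper bound of the modified stage cost. -/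
noncomputable def quadStage (δ : ℝ) (x : State n) (u : Fin m → ℝ) : ℝ :=
  x ⬝ᵥ ((S.Q + S.ε • barrierBound S.Cx S.wx δ) *ᵥ x)
    + u ⬝ᵥ ((S.R + S.ε • barrierBound S.Cu S.wu δ) *ᵥ u)

lemma quadStage_eq (δ : ℝ) (x : State n) (u : Fin m → ℝ) :
    S.quadStage δ x u = x ⬝ᵥ (S.Q *ᵥ x) + u ⬝ᵥ (S.R *ᵥ u)
      + S.ε * (x ⬝ᵥ (barrierBound S.Cx S.wx δ *ᵥ x))
      + S.ε * (u ⬝ᵥ (barrierBound S.Cu S.wu δ *ᵥ u)) := by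
  simp only [quadStage, Matrix.add_mulVec, Matrix.smul_mulVec, dotProduct_add, dotProduct_smul,
    smul_eq_mul]
  ring

lemma quadStage_smul (δ c : ℝ) (x : State n) (u : Fin m → ℝ) :
    S.quadStage δ (c • x) (c • u) = c ^ 2 * S.quadStage δ x u := by
  simp only [quadStage, Matrix.mulVec_smul, dotProduct_smul, smul_dotProduct, smul_eq_mul]
  ring

lemma continuous_quadStage (δ : ℝ) :
    Continuous fun p : State n × (Fin m → ℝ) => S.quadStage δ p.1 p.2 := by
  unfold quadStage
  fun_prop

variable {S}

lemma Valid.dotProduct_Q_nonneg (hS : S.Valid) (x : State n) : 0 ≤ x ⬝ᵥ (S.Q *ᵥ x) := by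
  simpa using hS.Q_posSemidef.dotProduct_mulVec_nonneg x

lemma Valid.dotProduct_R_nonneg (hS : S.Valid) (u : Fin m → ℝ) : 0 ≤ u ⬝ᵥ (S.R *ᵥ u) := by
  simpa using hS.R_posDef.posSemidef.dotProduct_mulVec_nonneg u

lemma Valid.quadStage_le (hS : S.Valid) {δ : ℝ} (hδ : 0 < δ) (hδ1 : δ ≤ 1) (x : State n)
    (u : Fin m → ℝ) : S.quadStage δ x u ≤ (δ⁻¹) ^ 2 * S.quadStage 1 x u := by
  have scale : ∀ {q r : ℕ} (C : Matrix (Fin q) (Fin r) ℝ) (w : Fin q → ℝ) (ξ : Fin r → ℝ),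
      ξ ⬝ᵥ (barrierBound C w δ *ᵥ ξ) = (δ⁻¹) ^ 2 * (ξ ⬝ᵥ (barrierBound C w 1 *ᵥ ξ)) := by
    intro q r C w ξ
    rw [dotProduct_barrierBound_mulVec, dotProduct_barrierBound_mulVec, Finset.mul_sum]
    refine Finset.sum_congr rfl fun i _ => ?_
    field_simp
  have h1 : 1 ≤ (δ⁻¹) ^ 2 := one_le_pow₀ ((one_le_inv₀ hδ).2 hδ1)
  rw [quadStage_eq, quadStage_eq, scale, scale]
  nlinarith [hS.dotProduct_Q_nonneg x, hS.dotProduct_R_nonneg u]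

/-- The sizes of the relaxation parameter for which the barrier functions are nonnegative. -/
structure AdmissibleRelaxation (S : Setup n m N qx qu) (δ : ℝ) : Prop where
  pos : 0 < δ
  le_dx : ∀ i, δ ≤ S.dx i
  le_du : ∀ j, δ ≤ S.du j

lemma Valid.barrier_le_stageCost (hS : S.Valid) (δ : ℝ) (x : State n) (u : Fin m → ℝ) :
    S.ε * relaxedBarrier S.Cx S.dx S.wx δ x + S.ε * relaxedBarrier S.Cu S.du S.wu δ u
      ≤ S.stageCost δ x u := by
  have h1 := hS.dotProduct_Q_nonneg x
  have h2 := hS.dotProduct_R_nonneg u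
  rw [stageCost]
  linarith

lemma Valid.state_barrier_nonneg (hS : S.Valid) {δ : ℝ} (hδ : S.AdmissibleRelaxation δ)
    (x : State n) : 0 ≤ S.ε * relaxedBarrier S.Cx S.dx S.wx δ x :=
  mul_nonneg hS.ε_pos.le (relaxedBarrier_nonneg hS.wx_recentering hS.wx_nonneg hδ.pos hδ.le_dx x)

lemma Valid.input_barrier_nonneg (hS : S.Valid) {δ : ℝ} (hδ : S.AdmissibleRelaxation δ)
    (u : Fin m → ℝ) : 0 ≤ S.ε * relaxedBarrier S.Cu S.du S.wu δ u :=
  mul_nonneg hS.ε_pos.le (relaxedBarrier_nonneg hS.wu_recentering hS.wu_nonneg hδ.pos hδ.le_du u)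

lemma Valid.stageCost_nonneg (hS : S.Valid) {δ : ℝ} (hδ : S.AdmissibleRelaxation δ)
    (x : State n) (u : Fin m → ℝ) : 0 ≤ S.stageCost δ x u :=
  (add_nonneg (hS.state_barrier_nonneg hδ x) (hS.input_barrier_nonneg hδ u)).trans
    (hS.barrier_le_stageCost δ x u)

lemma Valid.stageCost_le_quadStage (hS : S.Valid) {δ : ℝ} (hδ : S.AdmissibleRelaxation δ)
    (x : State n) (u : Fin m → ℝ) : S.stageCost δ x u ≤ S.quadStage δ x u := by
  rw [quadStage_eq, stageCost]
  have h1 := mul_le_mul_of_nonneg_left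
    (relaxedBarrier_le hS.wx_recentering hS.wx_nonneg hδ.pos hδ.le_dx x) hS.ε_pos.le
  have h2 := mul_le_mul_of_nonneg_left
    (relaxedBarrier_le hS.wu_recentering hS.wu_nonneg hδ.pos hδ.le_du u) hS.ε_pos.le
  linarith

lemma add_dotProduct_mulVec_add_add_sub {r : ℕ} (M : Matrix (Fin r) (Fin r) ℝ)
    (ξ η : Fin r → ℝ) :
    (ξ + η) ⬝ᵥ (M *ᵥ (ξ + η)) + (ξ - η) ⬝ᵥ (M *ᵥ (ξ - η)) - 2 * (ξ ⬝ᵥ (M *ᵥ ξ))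
      = 2 * (η ⬝ᵥ (M *ᵥ η)) := by
  simp only [Matrix.mulVec_add, Matrix.mulVec_sub, dotProduct_add, dotProduct_sub, add_dotProduct,
    sub_dotProduct]
  ring

lemma Valid.stageCost_add_sub_le (hS : S.Valid) {δ : ℝ} (hδ : 0 < δ) (x y : State n)
    (u v : Fin m → ℝ) :
    S.stageCost δ (x + y) (u + v) + S.stageCost δ (x - y) (u - v) - 2 * S.stageCost δ x u
      ≤ 2 * S.quadStage δ y v := by
  rw [quadStage_eq]
  simp only [stageCost]
  have h1 := mul_le_mul_of_nonneg_left
    (relaxedBarrier_add_sub_le (C := S.Cx) (d := S.dx) hS.wx_nonneg hδ x y) hS.ε_pos.le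
  have h2 := mul_le_mul_of_nonneg_left
    (relaxedBarrier_add_sub_le (C := S.Cu) (d := S.du) hS.wu_nonneg hδ u v) hS.ε_pos.le
  have h3 := add_dotProduct_mulVec_add_add_sub S.Q x y
  have h4 := add_dotProduct_mulVec_add_add_sub S.R u v
  linarith

/-! ### The Riccati equation. -/

section TerminalWeight

variable {δ : ℝ} {P : Matrix (Fin n) (Fin n) ℝ}

lemma Valid.inputHessian_posDef (hS : S.Valid) (hP : P.PosSemidef) :
    (S.R + S.Bᵀ * P * S.B + S.ε • barrierBound S.Cu S.wu δ).PosDef := by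
  have h1 := hP.conjTranspose_mul_mul_same S.B
  rw [Matrix.conjTranspose_eq_transpose_of_trivial] at h1
  exact (hS.R_posDef.add_posSemidef h1).add_posSemidef
    ((barrierBound_posSemidef S.Cu hS.wu_nonneg δ).smul hS.ε_pos.le)

/-- Completion of squares for the Riccati equation. -/
lemma IsTerminalWeight.quadStage_add_next (hS : S.Valid) (hP : S.IsTerminalWeight δ P)
    (x : State n) (u : Fin m → ℝ) :
    S.quadStage δ x u + S.next x u ⬝ᵥ (P *ᵥ S.next x u) = x ⬝ᵥ (P *ᵥ x)
      + (u - S.gain δ P *ᵥ x) ⬝ᵥ ((S.R + S.Bᵀ * P * S.B + S.ε • barrierBound S.Cu S.wu δ)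
        *ᵥ (u - S.gain δ P *ᵥ x)) := by
  have hH := hS.inputHessian_posDef (δ := δ) hP.posDef.posSemidef
  have hric := hP.riccati
  set K := S.gain δ P with hK
  set H := S.R + S.Bᵀ * P * S.B + S.ε • barrierBound S.Cu S.wu δ with hHdef
  set R' := S.R + S.ε • barrierBound S.Cu S.wu δ with hR'
  set Q' := S.Q + S.ε • barrierBound S.Cx S.wx δ with hQ'
  obtain ⟨e, rfl⟩ : ∃ e, u = K *ᵥ x + e := ⟨u - K *ᵥ x, by abel⟩
  have hHR : H = R' + S.Bᵀ * P * S.B := by rw [hHdef, hR']; abel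
  have hKeq : H * K = -(S.Bᵀ * P * S.A) := by
    rw [hK, gain, ← hHdef, Matrix.mul_neg, ← Matrix.mul_assoc,
      Matrix.mul_nonsing_inv _ ((Matrix.isUnit_iff_isUnit_det _).1 hH.isUnit), Matrix.one_mul]
  -- Stationarity of the quadratic in `u` at `u = K *ᵥ x`; it removes the terms linear in the
  -- deviation `e`.
  have hcross : S.Bᵀ * P * (S.A + S.B * K) + R' * K = 0 := by
    have : S.Bᵀ * P * (S.A + S.B * K) + R' * K = S.Bᵀ * P * S.A + H * K := by
      rw [hHR]
      simp only [Matrix.mul_add, Matrix.add_mul, Matrix.mul_assoc]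
      abel
    rw [this, hKeq]
    abel
  have hcross' : (S.B *ᵥ e) ⬝ᵥ (P *ᵥ ((S.A + S.B * K) *ᵥ x)) + e ⬝ᵥ (R' *ᵥ (K *ᵥ x)) = 0 := by
    have h1 : e ⬝ᵥ ((S.Bᵀ * P * (S.A + S.B * K) + R' * K) *ᵥ x) = 0 := by
      rw [hcross, Matrix.zero_mulVec, dotProduct_zero]
    rw [Matrix.add_mulVec, dotProduct_add, Matrix.mul_assoc, ← Matrix.mulVec_mulVec,
      ← Matrix.mulVec_mulVec, ← Matrix.mulVec_mulVec, Matrix.dotProduct_mulVec e,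
      Matrix.vecMul_transpose] at h1
    exact h1
  have hnext : S.next x (K *ᵥ x + e) = (S.A + S.B * K) *ᵥ x + S.B *ᵥ e := by
    rw [next, Matrix.mulVec_add, Matrix.add_mulVec, ← Matrix.mulVec_mulVec]
    abel
  have hxPx : x ⬝ᵥ (P *ᵥ x) = ((S.A + S.B * K) *ᵥ x) ⬝ᵥ (P *ᵥ ((S.A + S.B * K) *ᵥ x))
      + (K *ᵥ x) ⬝ᵥ (R' *ᵥ (K *ᵥ x)) + x ⬝ᵥ (Q' *ᵥ x) := by
    have h1 : x ⬝ᵥ (P *ᵥ x) = x ⬝ᵥ (((S.A + S.B * K)ᵀ * P * (S.A + S.B * K)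
        + Kᵀ * R' * K + Q') *ᵥ x) := by
      conv_lhs => rw [hric]
      rw [hQ', ← add_assoc]
    rw [h1, Matrix.add_mulVec, Matrix.add_mulVec, dotProduct_add, dotProduct_add]
    simp only [Matrix.mul_assoc]
    rw [← Matrix.mulVec_mulVec x, ← Matrix.mulVec_mulVec x, ← Matrix.mulVec_mulVec x,
      ← Matrix.mulVec_mulVec x, Matrix.dotProduct_mulVec x (S.A + S.B * K)ᵀ,
      Matrix.vecMul_transpose, Matrix.dotProduct_mulVec x Kᵀ, Matrix.vecMul_transpose]
  have heHe : e ⬝ᵥ (H *ᵥ e) = e ⬝ᵥ (R' *ᵥ e) + (S.B *ᵥ e) ⬝ᵥ (P *ᵥ (S.B *ᵥ e)) := by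
    rw [hHR, Matrix.add_mulVec, dotProduct_add, Matrix.mul_assoc, ← Matrix.mulVec_mulVec,
      ← Matrix.mulVec_mulVec, Matrix.dotProduct_mulVec e S.Bᵀ, Matrix.vecMul_transpose]
  have symm : ∀ {r : ℕ} {M : Matrix (Fin r) (Fin r) ℝ}, M.IsHermitian → ∀ ξ η : Fin r → ℝ,
      ξ ⬝ᵥ (M *ᵥ η) = η ⬝ᵥ (M *ᵥ ξ) := by
    intro r M hM ξ η
    have hM' : Mᵀ = M := by simpa [Matrix.IsHermitian] using hM
    rw [Matrix.dotProduct_mulVec, ← Matrix.mulVec_transpose, hM', dotProduct_comm]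
  have hR'symm : R'.IsHermitian := hS.R_posDef.isHermitian.add
    ((barrierBound_posSemidef S.Cu hS.wu_nonneg δ).smul hS.ε_pos.le).isHermitian
  have s1 := symm hP.posDef.isHermitian ((S.A + S.B * K) *ᵥ x) (S.B *ᵥ e)
  have s2 := symm hR'symm (K *ᵥ x) e
  rw [hnext, quadStage, ← hQ', ← hR', add_sub_cancel_left, hxPx, heHe]
  simp only [Matrix.mulVec_add, dotProduct_add, add_dotProduct]
  linarith

end TerminalWeight

end Setup

/-! ### Descent of the cost in closed loop, and bounds uniform in `δ`. -/

namespace Setup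

variable {n m N qx qu : ℕ} {S : Setup n m N qx qu} {δ : ℝ} {P : Matrix (Fin n) (Fin n) ℝ}

variable (S) in
/-- The quadratic upper bound of the summed modified stage costs of a predicted trajectory. -/
noncomputable def quadCost (δ : ℝ) (U : InputSeq N m) (x : State n) : ℝ :=
  ∑ k ∈ Finset.range N, S.quadStage δ (S.predState U x k) (block U k)

variable (S) in
lemma quadCost_smul (δ c : ℝ) (U : InputSeq N m) (x : State n) :
    S.quadCost δ (c • U) (c • x) = c ^ 2 * S.quadCost δ U x := by
  simp only [quadCost, predState_smul, block_smul, quadStage_smul, Finset.mul_sum]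

variable (S) in
lemma continuous_quadCost (δ : ℝ) :
    Continuous fun p : InputSeq N m × State n => S.quadCost δ p.1 p.2 :=
  continuous_finsetSum _ fun k _ => (S.continuous_quadStage δ).comp
    ((S.continuous_predState k).prodMk ((continuous_block k).comp continuous_fst))

lemma Valid.quadCost_le (hS : S.Valid) (hδ : 0 < δ) (hδ1 : δ ≤ 1) (U : InputSeq N m)
    (x : State n) : S.quadCost δ U x ≤ S.quadCost 1 (δ⁻¹ • U) (δ⁻¹ • x) := by
  rw [quadCost_smul, quadCost, quadCost, Finset.mul_sum]
  exact Finset.sum_le_sum fun k _ => hS.quadStage_le hδ hδ1 _ _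

lemma IsTerminalWeight.dotProduct_nonneg (hP : S.IsTerminalWeight δ P) (x : State n) :
    0 ≤ x ⬝ᵥ (P *ᵥ x) := by
  simpa using hP.posDef.posSemidef.dotProduct_mulVec_nonneg x

lemma IsTerminalWeight.dotProduct_le_quadStage_add_next (hS : S.Valid)
    (hP : S.IsTerminalWeight δ P) (x : State n) (u : Fin m → ℝ) :
    x ⬝ᵥ (P *ᵥ x) ≤ S.quadStage δ x u + S.next x u ⬝ᵥ (P *ᵥ S.next x u) := by
  rw [hP.quadStage_add_next hS]
  have h1 := (hS.inputHessian_posDef (δ := δ)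
    hP.posDef.posSemidef).posSemidef.dotProduct_mulVec_nonneg (u - S.gain δ P *ᵥ x)
  rw [star_trivial] at h1
  linarith

/-- The terminal cost is at most the quadratic cost of any trajectory to the origin. -/
lemma IsTerminalWeight.dotProduct_le_quadCost (hS : S.Valid) (hP : S.IsTerminalWeight δ P)
    {U : InputSeq N m} {x : State n} (hU : S.predState U x N = 0) :
    x ⬝ᵥ (P *ᵥ x) ≤ S.quadCost δ U x := by
  -- The summation length is freed from `N` for the induction; blocks beyond the horizon are zero,
  -- and the one-step inequality holds for any input.
  have key : ∀ M, x ⬝ᵥ (P *ᵥ x)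
      ≤ ∑ k ∈ Finset.range M, S.quadStage δ (S.predState U x k) (block U k)
        + S.predState U x M ⬝ᵥ (P *ᵥ S.predState U x M) := fun M => by
    induction M with
    | zero => simp [predState]
    | succ M ih =>
      have h1 := hP.dotProduct_le_quadStage_add_next hS (S.predState U x M) (block U M)
      rw [Finset.sum_range_succ, predState]
      linarith
  simpa [hU, quadCost] using key N

lemma Valid.cost_shift (hS : S.Valid) (δ : ℝ) (P : Matrix (Fin n) (Fin n) ℝ)
    (U : InputSeq N m) (v : Fin m → ℝ) (x : State n) :
    S.cost δ P (shift U v) (S.next x (block U 0)) + S.stageCost δ x (block U 0)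
      = S.cost δ P U x - S.predState U x N ⬝ᵥ (P *ᵥ S.predState U x N)
        + S.stageCost δ (S.predState U x N) v
        + S.next (S.predState U x N) v ⬝ᵥ (P *ᵥ S.next (S.predState U x N) v) := by
  have hN := hS.horizon_pos
  rw [cost, cost, predState_shift_horizon _ hN]
  obtain ⟨M, rfl⟩ : ∃ M, N = M + 1 := ⟨N - 1, by omega⟩
  rw [Finset.sum_range_succ, S.predState_shift U v x le_rfl, block_shift_of_eq U v rfl,
    Finset.sum_range_succ' _ M]
  have h1 : ∑ k ∈ Finset.range M, S.stageCost δ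
      (S.predState (shift U v) (S.next x (block U 0)) k) (block (shift U v) k)
      = ∑ k ∈ Finset.range M, S.stageCost δ (S.predState U x (k + 1)) (block U (k + 1)) :=
    Finset.sum_congr rfl fun k hk => by
      have hk' := Finset.mem_range.1 hk
      rw [S.predState_shift U v x (by omega), block_shift_of_lt U v (by omega)]
  rw [h1, show S.predState U x 0 = x from rfl]
  ring

/-- With the input `K x_N` the square in the Riccati identity vanishes, so the quadratic majorant of
the appended stage cost equals the drop of the terminal cost. -/
lemma IsTerminalWeight.isTerminalFeedback (hS : S.Valid) (hδ : S.AdmissibleRelaxation δ)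
    (hP : S.IsTerminalWeight δ P) :
    S.IsTerminalFeedback δ P (fun U x => (S.gain δ P).mulVec (S.predState U x N)) where
  zero := by rw [predState_zero, Matrix.mulVec_zero]
  decrease U x := by
    have h1 := hS.cost_shift δ P U (S.gain δ P *ᵥ S.predState U x N) x
    have h2 := hP.quadStage_add_next hS (S.predState U x N) (S.gain δ P *ᵥ S.predState U x N)
    have h3 := hS.stageCost_le_quadStage hδ (S.predState U x N)
      (S.gain δ P *ᵥ S.predState U x N)
    rw [sub_self, zero_dotProduct] at h2
    linarith

lemma IsTerminalWeight.stageCost_le_cost (hS : S.Valid) (hδ : S.AdmissibleRelaxation δ)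
    (hP : S.IsTerminalWeight δ P) (U : InputSeq N m) (x : State n) :
    S.stageCost δ x (block U 0) ≤ S.cost δ P U x := by
  have h1 := Finset.single_le_sum
    (f := fun k => S.stageCost δ (S.predState U x k) (block U k))
    (fun k _ => hS.stageCost_nonneg hδ _ _) (Finset.mem_range.2 hS.horizon_pos)
  exact h1.trans (le_add_of_nonneg_right (hP.dotProduct_nonneg _))

lemma cost_algo_le {kf : InputSeq N m → State n → Fin m → ℝ}
    {Ψ : InputSeq N m → State n → InputSeq N m} (hkf : S.IsTerminalFeedback δ P kf)
    (hΨ : S.IsOptimizerUpdate δ P Ψ) (U : InputSeq N m) (x : State n) (i : ℕ) :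
    S.cost δ P (S.algo kf Ψ U x i) (S.next x (block U 0)) + S.stageCost δ x (block U 0)
      ≤ S.cost δ P U x := by
  induction i with
  | zero =>
    have h1 := hkf.decrease U x
    rw [algo]
    linarith
  | succ i ih =>
    obtain ⟨γ, h0, -, hdec⟩ := hΨ
    have h1 := h0 (S.algo kf Ψ U x i) (S.next x (block U 0))
    have h2 := hdec (S.algo kf Ψ U x i) (S.next x (block U 0))
    rw [algo]
    linarith

lemma Valid.cost_closedLoop_le (hS : S.Valid) (hδ : S.AdmissibleRelaxation δ)
    {kf : InputSeq N m → State n → Fin m → ℝ} {Ψ : InputSeq N m → State n → InputSeq N m}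
    (hkf : S.IsTerminalFeedback δ P kf) (hΨ : S.IsOptimizerUpdate δ P Ψ) (iT : ℕ → ℕ)
    (U : InputSeq N m) (x : State n) (k : ℕ) :
    S.cost δ P (S.closedLoop kf Ψ iT U x k).2 (S.closedLoop kf Ψ iT U x k).1
      ≤ S.cost δ P U x := by
  induction k with
  | zero => rfl
  | succ k ih =>
    have h1 := cost_algo_le hkf hΨ (S.closedLoop kf Ψ iT U x k).2
      (S.closedLoop kf Ψ iT U x k).1 (iT k)
    have h2 := hS.stageCost_nonneg hδ (S.closedLoop kf Ψ iT U x k).1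
      (block (S.closedLoop kf Ψ iT U x k).2 0)
    rw [closedLoop]
    linarith

/-- At a minimizer `U`, replacing `cost (U - V)` by the smaller `cost U` bounds `cost (U + V) - cost
U`, without any gradient. -/
lemma Valid.cost_add_sub_le (hS : S.Valid) (hδ : 0 < δ) (U V : InputSeq N m) (x : State n) :
    S.cost δ P (U + V) x + S.cost δ P (U - V) x - 2 * S.cost δ P U x
      ≤ 2 * (S.quadCost δ V 0 + S.predState V 0 N ⬝ᵥ (P *ᵥ S.predState V 0 N)) := by
  have hadd : ∀ k, S.predState (U + V) x k = S.predState U x k + S.predState V 0 k := fun k => by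
    rw [← predState_add, add_zero]
  have hsub : ∀ k, S.predState (U - V) x k = S.predState U x k - S.predState V 0 k := fun k => by
    rw [eq_sub_iff_add_eq, ← predState_add, add_zero, sub_add_cancel]
  have hbsub : ∀ k, block (U - V) k = block U k - block V k := fun k => by
    rw [eq_sub_iff_add_eq, ← block_add, sub_add_cancel]
  have h1 : ∑ k ∈ Finset.range N, S.stageCost δ (S.predState (U + V) x k) (block (U + V) k)
      + ∑ k ∈ Finset.range N, S.stageCost δ (S.predState (U - V) x k) (block (U - V) k)
      - 2 * ∑ k ∈ Finset.range N, S.stageCost δ (S.predState U x k) (block U k)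
      ≤ 2 * S.quadCost δ V 0 := by
    rw [quadCost, Finset.mul_sum, Finset.mul_sum, ← Finset.sum_add_distrib,
      ← Finset.sum_sub_distrib]
    refine Finset.sum_le_sum fun k _ => ?_
    rw [hadd, hsub, hbsub, block_add]
    exact hS.stageCost_add_sub_le hδ _ _ _ _
  have h2 := add_dotProduct_mulVec_add_add_sub P (S.predState U x N) (S.predState V 0 N)
  simp only [cost]
  rw [hadd N, hsub N]
  linarith

/-- The conditions on `δ` say `β / ε ≤ log (d i / δ)`; a violation would cost strictly more than
`β`, by the extra `1/2`. -/
lemma Valid.mem_of_barrier_le (hS : S.Valid) (hδ : S.AdmissibleRelaxation δ) {β : ℝ}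
    (hx : ∀ i, δ ≤ S.dx i * Real.exp (-(β / S.ε)))
    (hu : ∀ j, δ ≤ S.du j * Real.exp (-(β / S.ε))) {x : State n} {u : Fin m → ℝ}
    (hβ : S.stageCost δ x u ≤ β) : x ∈ S.stateSet ∧ u ∈ S.inputSet := by
  have h1 := hS.barrier_le_stageCost δ x u
  have h2 := hS.state_barrier_nonneg hδ x
  have h3 := hS.input_barrier_nonneg hδ u
  have key : ∀ d b, 0 < d → δ ≤ d * Real.exp (-(β / S.ε)) → 1 / 2 + Real.log (d / δ) ≤ b →
      S.ε * b ≤ β → False := by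
    intro d b hd hδd hb hβ
    have h4 : Real.exp (β / S.ε) ≤ d / δ := by
      rw [le_div_iff₀ hδ.pos]
      calc Real.exp (β / S.ε) * δ
          ≤ Real.exp (β / S.ε) * (d * Real.exp (-(β / S.ε))) := by gcongr
        _ = d * (Real.exp (β / S.ε) * Real.exp (-(β / S.ε))) := by ring
        _ = d := by rw [← Real.exp_add, add_neg_cancel, Real.exp_zero, mul_one]
    have h5 : β / S.ε ≤ Real.log (d / δ) :=
      (Real.le_log_iff_exp_le (div_pos hd hδ.pos)).2 h4
    have h6 : b ≤ β / S.ε := by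
      rw [le_div_iff₀ hS.ε_pos]
      linarith
    linarith
  constructor
  · intro i
    by_contra! hi
    exact key _ _ (hS.dx_pos i) (hx i) (le_relaxedBarrier_of_violated hS.wx_recentering
      hS.wx_nonneg hδ.pos hδ.le_dx hi.le) (by linarith)
  · intro j
    by_contra! hj
    exact key _ _ (hS.du_pos j) (hu j) (le_relaxedBarrier_of_violated hS.wu_recentering
      hS.wu_nonneg hδ.pos hδ.le_du hj.le) (by linarith)

/-- If the feasible set has interior points, every state can be steered to the origin within the
horizon by inputs that depend linearly on it. -/
lemma exists_linear_steering (h : (interior S.feasibleSet).Nonempty) :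
    ∃ T : State n →ₗ[ℝ] InputSeq N m, ∀ x, S.predState (T x) x N = 0 := by
  let W := LinearMap.ker (S.predStateLinear N)
  let f : W →ₗ[ℝ] State n := LinearMap.snd ℝ _ _ ∘ₗ W.subtype
  have hsub : S.feasibleSet ⊆ (LinearMap.range f : Set (State n)) := by
    rintro x ⟨U, -, -, hU⟩
    exact ⟨⟨(U, x), hU⟩, rfl⟩
  -- The steerable states form a subspace containing an open set, hence everything.
  have htop : LinearMap.range f = ⊤ :=
    Submodule.eq_top_of_nonempty_interior' _ (h.mono (interior_mono hsub))
  obtain ⟨g, hg⟩ := f.exists_rightInverse_of_surjective htop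
  refine ⟨LinearMap.fst ℝ _ _ ∘ₗ W.subtype ∘ₗ g, fun x => ?_⟩
  have h1 : (g x).1.2 = x := LinearMap.congr_fun hg x
  have h2 : S.predState (g x).1.1 (g x).1.2 N = 0 := (g x).2
  rwa [h1] at h2

/-- A radius proportional to `δ` on which the second order cost increment is at most one. -/
lemma Valid.exists_radius (hS : S.Valid) (h : (interior S.feasibleSet).Nonempty) :
    ∃ r : ℝ, 0 < r ∧ ∀ δ, 0 < δ → δ ≤ 1 → ∀ P, S.IsTerminalWeight δ P →
      ∀ V : InputSeq N m, ‖V‖ ≤ r * δ →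
        S.quadCost δ V 0 + S.predState V 0 N ⬝ᵥ (P *ᵥ S.predState V 0 N) ≤ 1 := by
  obtain ⟨T, hT⟩ := exists_linear_steering h
  -- `F` majorizes the increment at `δ = 1`, the terminal term being replaced by the cost of the
  -- linear steering. For general `δ`, homogeneity gives the majorant `F (δ⁻¹ • V)`.
  let F : InputSeq N m → ℝ := fun V =>
    S.quadCost 1 V 0 + S.quadCost 1 (T (S.predState V 0 N)) (S.predState V 0 N)
  have hy : Continuous fun V : InputSeq N m => S.predState V 0 N :=
    (S.continuous_predState N).comp (continuous_id.prodMk continuous_const)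
  have hF : Continuous F :=
    ((S.continuous_quadCost 1).comp (continuous_id.prodMk continuous_const)).add
      ((S.continuous_quadCost 1).comp
        ((T.continuous_of_finiteDimensional.comp hy).prodMk hy))
  have hF0 : F 0 < 1 := by
    have h0 : S.quadCost 1 (0 : InputSeq N m) 0 = 0 := by
      simpa using S.quadCost_smul 1 0 (0 : InputSeq N m) 0
    simp [F, predState_zero, h0]
  obtain ⟨r, hr, hball⟩ := Metric.eventually_nhds_iff.1 (hF.continuousAt.eventually_lt
    continuousAt_const hF0)
  refine ⟨r / 2, half_pos hr, fun δ hδ hδ1 P hP V hV => ?_⟩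
  have h1 : F (δ⁻¹ • V) < 1 := by
    refine hball ?_
    rw [dist_zero_right, norm_smul, norm_inv, Real.norm_of_nonneg hδ.le, inv_mul_lt_iff₀ hδ]
    nlinarith
  have h2 := hS.quadCost_le hδ hδ1 V 0
  have h3 := hP.dotProduct_le_quadCost hS (hT (S.predState V 0 N))
  have h4 := hS.quadCost_le hδ hδ1 (T (S.predState V 0 N)) (S.predState V 0 N)
  have h5 : δ⁻¹ • S.predState V 0 N = S.predState (δ⁻¹ • V) 0 N := by
    rw [← predState_smul, smul_zero]
  rw [smul_zero] at h2
  rw [← map_smul, h5] at h4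
  simp only [F] at h1
  linarith

/-- On compact subsets of the interior of the feasible set, the inputs that steer to the origin
can be chosen with a uniform relative slack in all constraints. -/
lemma exists_uniform_slack {X₀ : Set (State n)} (hX₀ : IsCompact X₀)
    (hX₀N : X₀ ⊆ interior S.feasibleSet) :
    ∃ s : ℝ, 0 < s ∧ s < 1 ∧ ∀ x ∈ X₀, ∃ U : InputSeq N m, S.predState U x N = 0 ∧
      (∀ k < N, ∃ y ∈ S.stateSet, S.predState U x k = (1 - s) • y) ∧
      ∀ k < N, ∃ v ∈ S.inputSet, block U k = (1 - s) • v := by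
  obtain ⟨ρ, hρ, hsub⟩ := hX₀.exists_cthickening_subset_open isOpen_interior hX₀N
  obtain ⟨M, hM⟩ := hX₀.isBounded.exists_norm_le
  have hM' : 0 < |M| + 1 := by positivity
  -- Chosen so that stretching by `1 + t` moves points of `X₀` by at most `ρ`. Shrinking a feasible
  -- trajectory of the stretched state back by `(1 + t)⁻¹ = 1 - s` creates the slack.
  set t := ρ / (|M| + 1) with ht
  have ht0 : 0 < t := div_pos hρ hM'
  have hs : 1 - t / (1 + t) = (1 + t)⁻¹ := by
    field_simp
    ring
  refine ⟨t / (1 + t), by positivity, (div_lt_one (by positivity)).2 (by linarith),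
    fun x hx => ?_⟩
  have hmem : (1 + t) • x ∈ S.feasibleSet := by
    refine interior_subset (hsub (Metric.mem_cthickening_of_dist_le _ x ρ X₀ hx ?_))
    rw [dist_eq_norm, add_smul, one_smul, add_sub_cancel_left, norm_smul,
      Real.norm_of_nonneg ht0.le]
    calc t * ‖x‖ ≤ t * (|M| + 1) := by
          gcongr
          linarith [hM x hx, le_abs_self M]
      _ = ρ := div_mul_cancel₀ _ hM'.ne'
  obtain ⟨U, hu, hstate, hend⟩ := hmem
  have hpred : ∀ k, S.predState ((1 + t)⁻¹ • U) x k
      = (1 + t)⁻¹ • S.predState U ((1 + t) • x) k := fun k => by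
    rw [← predState_smul, inv_smul_smul₀ (by positivity)]
  rw [hs]
  exact ⟨(1 + t)⁻¹ • U, by rw [hpred, hend, smul_zero],
    fun k hk => ⟨_, hstate k hk, hpred k⟩, fun k hk => ⟨_, hu k hk, block_smul _ _ _⟩⟩

/-- The optimal cost is bounded uniformly in the relaxation parameter. -/
lemma Valid.exists_uniform_cost_bound (hS : S.Valid) {X₀ : Set (State n)} (hX₀ : IsCompact X₀)
    (hX₀N : X₀ ⊆ interior S.feasibleSet) :
    ∃ s α : ℝ, 0 < s ∧ s < 1 ∧ ∀ δ, 0 < δ → (∀ i, δ ≤ s * S.dx i) → (∀ j, δ ≤ s * S.du j) →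
      ∀ P, ∀ x ∈ X₀, ∃ U : InputSeq N m, S.cost δ P U x ≤ α := by
  obtain ⟨s, hs0, hs1, hslack⟩ := exists_uniform_slack hX₀ hX₀N
  have hcQ : Continuous fun y : State n => ((1 - s) • y) ⬝ᵥ (S.Q *ᵥ ((1 - s) • y)) := by
    fun_prop
  have hcR : Continuous fun v : Fin m → ℝ => ((1 - s) • v) ⬝ᵥ (S.R *ᵥ ((1 - s) • v)) := by
    fun_prop
  obtain ⟨cQ, hQ⟩ := hS.isCompact_stateSet.bddAbove_image hcQ.continuousOn
  obtain ⟨cR, hR⟩ := hS.isCompact_inputSet.bddAbove_image hcR.continuousOn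
  refine ⟨s, ∑ _k ∈ Finset.range N, (cQ + cR + S.ε * ∑ i, (1 + S.wx i) * (-Real.log s)
    + S.ε * ∑ j, (1 + S.wu j) * (-Real.log s)), hs0, hs1, fun δ hδ hdx hdu P x hx => ?_⟩
  obtain ⟨U, hend, hstate, hinput⟩ := hslack x hx
  refine ⟨U, ?_⟩
  rw [cost, hend, zero_dotProduct, add_zero]
  refine Finset.sum_le_sum fun k hk => ?_
  obtain ⟨y, hy, hyk⟩ := hstate k (Finset.mem_range.1 hk)
  obtain ⟨v, hv, hvk⟩ := hinput k (Finset.mem_range.1 hk)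
  have hs : 0 ≤ 1 - s := by linarith
  have h1 : relaxedBarrier S.Cx S.dx S.wx δ ((1 - s) • y) ≤ _ :=
    relaxedBarrier_le_of_slack hS.wx_nonneg hδ hs0 hS.dx_pos hdx fun i => by
      rw [Matrix.mulVec_smul]
      exact mul_le_mul_of_nonneg_left (hy i) hs
  have h2 : relaxedBarrier S.Cu S.du S.wu δ ((1 - s) • v) ≤ _ :=
    relaxedBarrier_le_of_slack hS.wu_nonneg hδ hs0 hS.du_pos hdu fun j => by
      rw [Matrix.mulVec_smul]
      exact mul_le_mul_of_nonneg_left (hv j) hs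
  have h3 := hQ (Set.mem_image_of_mem _ hy)
  have h4 := hR (Set.mem_image_of_mem _ hv)
  rw [hyk, hvk, stageCost]
  exact add_le_add (add_le_add (add_le_add h3 h4) (mul_le_mul_of_nonneg_left h1 hS.ε_pos.le))
    (mul_le_mul_of_nonneg_left h2 hS.ε_pos.le)

end Setup

/-! ### Choice of the constants and conclusion. -/

lemma isKInfty_const_mul {r : ℝ} (hr : 0 < r) : IsKInfty (fun t => r * t) where
  zero := mul_zero r
  continuousOn := by fun_prop
  strictMonoOn := fun _ _ _ _ h => mul_lt_mul_of_pos_left h hr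
  tendsto := Filter.tendsto_id.const_mul_atTop hr

lemma exists_pos_forall_le {q : ℕ} {c : Fin q → ℝ} (hc : ∀ i, 0 < c i) :
    ∃ δ : ℝ, 0 < δ ∧ ∀ i, δ ≤ c i := by
  rcases isEmpty_or_nonempty (Fin q) with h | h
  · exact ⟨1, one_pos, fun i => h.elim i⟩
  · obtain ⟨i, hi⟩ := Finite.exists_min c
    exact ⟨c i, hc i, hi⟩

end RelaxedMPC
theorem theorem3 {n m N qx qu : ℕ} (S : RelaxedMPC.Setup n m N qx qu) (hS : S.Valid)
    (hAB : RelaxedMPC.IsControllable S.A S.B)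
    (X₀ : Set (RelaxedMPC.State n)) (hX₀ : IsCompact X₀) (hX₀N : X₀ ⊆ interior S.feasibleSet)
    (zx : Fin qx → ℝ) (hzx : ∀ i, 0 ≤ zx i) (zu : Fin qu → ℝ) (hzu : ∀ j, 0 ≤ zu j) :
    ∃ (δ₀ : ℝ) (μ : ℝ → ℝ), 0 < δ₀ ∧ RelaxedMPC.IsKInfty μ ∧
      ∀ δ : ℝ, 0 < δ → δ ≤ δ₀ →
      ∀ P : Matrix (Fin n) (Fin n) ℝ, S.IsTerminalWeight δ P →
        S.IsTerminalFeedback δ P (fun U x => (S.gain δ P).mulVec (S.predState U x N)) ∧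
        ∀ kf : RelaxedMPC.InputSeq N m → RelaxedMPC.State n → Fin m → ℝ,
          S.IsTerminalFeedback δ P kf →
        ∀ Ψ : RelaxedMPC.InputSeq N m → RelaxedMPC.State n → RelaxedMPC.InputSeq N m,
          S.IsOptimizerUpdate δ P Ψ →
        ∀ x₀ ∈ X₀, ∀ Uopt : RelaxedMPC.InputSeq N m,
          IsMinOn (fun U => S.cost δ P U x₀) Set.univ Uopt →
        ∀ U₀ ∈ Metric.closedBall Uopt (μ δ), ∀ (iT : ℕ → ℕ) (k : ℕ),
          (∀ i, (S.Cx.mulVec (S.closedLoop kf Ψ iT U₀ x₀ k).1) i ≤ S.dx i + zx i) ∧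
          (∀ j, (S.Cu.mulVec (RelaxedMPC.block (S.closedLoop kf Ψ iT U₀ x₀ k).2 0)) j
            ≤ S.du j + zu j) := by
  have hε := hS.ε_pos
  -- For empty `X₀` the feasible set may have empty interior, so the radius lemma is not available;
  -- only the terminal feedback claim has content.
  rcases X₀.eq_empty_or_nonempty with rfl | ⟨xs, hxs⟩
  · obtain ⟨δx, hδx, hdx⟩ := RelaxedMPC.exists_pos_forall_le hS.dx_pos
    obtain ⟨δu, hδu, hdu⟩ := RelaxedMPC.exists_pos_forall_le hS.du_pos
    refine ⟨min δx δu, fun t => 1 * t, lt_min hδx hδu, RelaxedMPC.isKInfty_const_mul one_pos,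
      fun δ hδ hle P hP => ⟨hP.isTerminalFeedback hS ⟨hδ, ?_, ?_⟩, ?_⟩⟩
    · exact fun i => (hle.trans (min_le_left _ _)).trans (hdx i)
    · exact fun j => (hle.trans (min_le_right _ _)).trans (hdu j)
    · exact fun _ _ _ _ x hx => (Set.notMem_empty x hx).elim
  obtain ⟨r, hr, hradius⟩ := hS.exists_radius ⟨xs, hX₀N hxs⟩
  obtain ⟨s, α, hs0, hs1, hα⟩ := hS.exists_uniform_cost_bound hX₀ hX₀N
  -- The factor `s` serves the uniform cost bound; the exponential makes a violation cost more than
  -- `α + 2`.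
  have hc : 0 < min s (Real.exp (-((α + 2) / S.ε))) := lt_min hs0 (Real.exp_pos _)
  obtain ⟨δx, hδx, hdx⟩ := RelaxedMPC.exists_pos_forall_le
    fun i => mul_pos (hS.dx_pos i) hc
  obtain ⟨δu, hδu, hdu⟩ := RelaxedMPC.exists_pos_forall_le
    fun j => mul_pos (hS.du_pos j) hc
  refine ⟨min 1 (min δx δu), fun t => r * t, lt_min one_pos (lt_min hδx hδu),
    RelaxedMPC.isKInfty_const_mul hr, fun δ hδ hle P hP => ?_⟩
  have hδ1 : δ ≤ 1 := hle.trans (min_le_left _ _)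
  have hx : ∀ i, δ ≤ S.dx i * min s (Real.exp (-((α + 2) / S.ε))) := fun i =>
    (hle.trans ((min_le_right _ _).trans (min_le_left _ _))).trans (hdx i)
  have hu : ∀ j, δ ≤ S.du j * min s (Real.exp (-((α + 2) / S.ε))) := fun j =>
    (hle.trans ((min_le_right _ _).trans (min_le_right _ _))).trans (hdu j)
  have hxs' : ∀ i, δ ≤ s * S.dx i := fun i => (hx i).trans <| by
    rw [mul_comm s]
    exact mul_le_mul_of_nonneg_left (min_le_left _ _) (hS.dx_pos i).le
  have hus : ∀ j, δ ≤ s * S.du j := fun j => (hu j).trans <| by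
    rw [mul_comm s]
    exact mul_le_mul_of_nonneg_left (min_le_left _ _) (hS.du_pos j).le
  have hadm : S.AdmissibleRelaxation δ :=
    ⟨hδ, fun i => (hxs' i).trans (mul_le_of_le_one_left (hS.dx_pos i).le hs1.le),
      fun j => (hus j).trans (mul_le_of_le_one_left (hS.du_pos j).le hs1.le)⟩
  refine ⟨hP.isTerminalFeedback hS hadm, fun kf hkf Ψ hΨ x₀ hx₀ Uopt hopt U₀ hU₀ iT k => ?_⟩
  obtain ⟨U, hU⟩ := hα δ hδ hxs' hus P x₀ hx₀
  have hopt' : ∀ V, S.cost δ P Uopt x₀ ≤ S.cost δ P V x₀ := fun V => hopt (Set.mem_univ V)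
  have hV := hradius δ hδ hδ1 P hP (U₀ - Uopt) (by
    rw [← dist_eq_norm]
    exact Metric.mem_closedBall.1 hU₀)
  have h1 := hS.cost_add_sub_le (P := P) hδ Uopt (U₀ - Uopt) x₀
  rw [add_sub_cancel] at h1
  -- Comparison with the reflection of `U₀` in `Uopt`: the initial cost exceeds the optimal one by
  -- at most `2`, which gives the level `α + 2`.
  have h2 := hopt' (Uopt - (U₀ - Uopt))
  have h3 := hopt' U
  have h4 := hS.cost_closedLoop_le hadm hkf hΨ iT U₀ x₀ k
  have h5 := hP.stageCost_le_cost hS hadm (S.closedLoop kf Ψ iT U₀ x₀ k).2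
    (S.closedLoop kf Ψ iT U₀ x₀ k).1
  obtain ⟨hstate, hinput⟩ := hS.mem_of_barrier_le hadm (β := α + 2)
    (fun i => (hx i).trans (mul_le_mul_of_nonneg_left (min_le_right _ _) (hS.dx_pos i).le))
    (fun j => (hu j).trans (mul_le_mul_of_nonneg_left (min_le_right _ _) (hS.du_pos j).le))
    (by linarith : S.stageCost δ (S.closedLoop kf Ψ iT U₀ x₀ k).1
      (RelaxedMPC.block (S.closedLoop kf Ψ iT U₀ x₀ k).2 0) ≤ α + 2)
  exact ⟨fun i => (hstate i).trans (le_add_of_nonneg_right (hzx i)),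
    fun j => (hinput j).trans (le_add_of_nonneg_right (hzu j))⟩
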